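/- A Latvian game on a finite simple undirected graph $G$ with hatness function $h : V(G)\to\{2,3,4,\dots\}$ is played as follows. A coloring $c$ assigns to each vertex $v$ a color $c(v)\in\{0,\dots,h(v)-1\}$. A strategy $f$ gives each vertex $v$ a function $f_v$ that maps every possible coloring of the neighbors of $v$ to a single guess in $\{0,\dots,h(v)-1\}$. The game is winnable if there is a strategy $f$ such that for every coloring $c$ there is a vertex $v$ with $f_v\bigl(c|_{N(v)}\bigr)=c(v)$. A vertex $a$ is deletable if the game on $G\setminus a$, with the same hatnesses on the remaining vertices, is winnable if and only if the game on $G$ is winnable. The game contains the hatness sequence $(s_1,\dots,s_n)$ if $s_1,\dots,s_n$ are the hatnesses encountered, in order, when traversing some path of $G$ (without repeated vertices). Theorem. Let $k\ge 4$, let $h : V(C_k)\to\{2,3,4,\dots\}$, and consider the Latvian game on the cycle $C_k$ with hatness function $h$. Suppose $h(a)\ge 5$ for some vertex $a$. Then $a$ is deletable. Moreover, the game is winnable if and only if it contains a hatness sequence $(2,c_1,\dots,c_m,2)$ with $m\ge 0$ and $c_i\in\{3,4\}$ for all $i$. -/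

import Mathlib

/-- A Latvian game (single-guess hat guessing game) on an undirected visibility graph:
the sage at `v` sees exactly the hats of her neighbours, and her own hat has one of
`hatness v` possible colors. -/
structure LatvianGame (V : Type*) where
  /-- the visibility graph -/
  graph : SimpleGraph V
  /-- the number of possible hat colors of each vertex -/
  hatness : V → ℕ

namespace LatvianGame

variable {V : Type*}

/-- A coloring: a hat color for every sage, the color set of `v` being `Fin (hatness v)`. -/
abbrev Coloring (G : LatvianGame V) : Type _ :=
  (v : V) → Fin (G.hatness v)

/-- A strategy: for every sage `v`, a plan that turns the colors she sees on her neighbours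
into a (single) guess of her own color. -/
abbrev Strategy (G : LatvianGame V) : Type _ :=
  (v : V) → ((u : G.graph.neighborSet v) → Fin (G.hatness u)) → Fin (G.hatness v)

/-- The sage at `v` guesses right when the hats are placed according to `c` and everybody
follows `f`. -/
def GuessesRight (G : LatvianGame V) (f : G.Strategy) (c : G.Coloring) (v : V) : Prop :=
  f v (fun u => c u) = c v

/-- A strategy wins if, for every coloring, some sage guesses right (there is no disprover). -/
def Wins (G : LatvianGame V) (f : G.Strategy) : Prop :=
  ∀ c : G.Coloring, ∃ v : V, G.GuessesRight f c v

/-- A game is winnable if it has a winning strategy. -/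
def Winnable (G : LatvianGame V) : Prop :=
  ∃ f : G.Strategy, G.Wins f

/-- The game with the vertex `v` (and all edges at it) deleted; the other hatnesses are kept. -/
def delete (G : LatvianGame V) (v : V) : LatvianGame {u : V | u ≠ v} where
  graph := G.graph.induce {u : V | u ≠ v}
  hatness := fun u => G.hatness u

/-- A vertex is deletable if deleting it does not change the outcome of the game. -/
def Deletable (G : LatvianGame V) (v : V) : Prop :=
  (G.delete v).Winnable ↔ G.Winnable

/-- The game contains the hatness sequence `l`: the entries of `l` are the hatnesses that one
encounters, in order, while traversing some path (without repeated vertices) of the graph. -/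
def ContainsHatnessSequence (G : LatvianGame V) (l : List ℕ) : Prop :=
  ∃ (u v : V) (p : G.graph.Walk u v), p.IsPath ∧ p.support.map G.hatness = l

end LatvianGame

/-- The Latvian game on the cycle with vertices `0, …, k - 1`, where `i` and `j` are adjacent
iff `i - j ≡ ±1` modulo `k` (for `k ≥ 3` this is the cycle `C_k`). -/
def latvianCycle (k : ℕ) (h : Fin k → ℕ) : LatvianGame (Fin k) where
  graph := SimpleGraph.cycleGraph k
  hatness := h

/-! A path of hatnesses `2, 3 or 4, …, 2` wins by a bit game on its edges (`winnable_of_path`). All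
its hatnesses are below five, so it avoids `a` and survives the deletion of `a`. Hence both claims
follow once such a path is shown to be necessary.

For necessity, number the cycle `0, …, N` with `a` at `N`. Without such a path, any two vertices of
hatness two among `0, …, N - 1` have a hatness of at least five between them, and a disproving
coloring is built. `alive_invariant` does this along a path. After a vertex of hatness two, only a
pair of colors is guaranteed, one of which always works. A hatness of at least five restores the
stronger property needed to pass the next two.

To close up at `a`, note that five colors beat four guesses, so the color of `a` can be fixed while
two candidates remain at each of its neighbors. A neighbor of hatness two has only two colors. At a
larger one, `exists_majority` supplies two candidates that keep its other neighbor wrong, and its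
own guess rules out at most one. On `C_4` the two majorities may concern the same vertex;
`exists_disproves_square` then counts instead. -/

/-! ### Disproving colorings of paths -/

/-- Colors of the vertices `0, 1, 2, …` of a path are natural numbers, the hatness of `i` being
`n i`, and `g i l r` is the guess of `i` when its neighbors have colors `l` and `r` (vertex `0`
has no left neighbor, and sees `0` there). `Alive n g r v l` says that the coloring `v` of `r` and
`l` of `r + 1` extends to a coloring of `0, …, r + 1` for which none of `0, …, r` guesses right. -/
def Alive (n : ℕ → ℕ) (g : ℕ → ℕ → ℕ → ℕ) : ℕ → ℕ → ℕ → Prop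
  | 0, v, l => v < n 0 ∧ v ≠ g 0 0 l
  | r + 1, v, l => v < n (r + 1) ∧ ∃ u, Alive n g r u v ∧ v ≠ g (r + 1) u l

theorem Alive.exists_coloring {n : ℕ → ℕ} {g : ℕ → ℕ → ℕ → ℕ} {r v l : ℕ}
    (h : Alive n g r v l) :
    ∃ c : ℕ → ℕ, c (r + 1) = l ∧ c r = v ∧ (∀ i ≤ r, c i < n i) ∧ c 0 ≠ g 0 0 (c 1) ∧
      ∀ i < r, c (i + 1) ≠ g (i + 1) (c i) (c (i + 2)) := by
  induction r generalizing v l with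
  | zero =>
    refine ⟨fun i => if i = 0 then v else l, by simp, by simp, ?_, ?_, by simp⟩
    · intro i hi
      obtain rfl : i = 0 := by omega
      simpa using h.1
    · simpa using h.2
  | succ r ih =>
    obtain ⟨hv, u, hu, hg⟩ := h
    obtain ⟨c, h1, h2, h3, h4, h5⟩ := ih hu
    refine ⟨fun i => if i ≤ r + 1 then c i else l, by simp, by simpa using h1, ?_, by simpa using h4,
      ?_⟩
    · intro i hi
      rcases Nat.lt_or_eq_of_le hi with hi | rfl
      · simpa [hi.le] using h3 i (by omega)
      · simpa [h1] using hv
    · intro i hi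
      rcases Nat.lt_or_eq_of_le (Nat.le_of_lt_succ hi) with hi | rfl
      · have := h5 i hi
        beta_reduce
        rwa [if_pos (by omega), if_pos (by omega), if_pos (by omega)]
      · beta_reduce
        rw [if_pos (by omega), if_pos (by omega), if_neg (by omega), h1, h2]
        exact hg

/-- Among the vertices `0, …, r` there is one of hatness two, and no later one of hatness at least
five. -/
def TwoOpen (n : ℕ → ℕ) (r : ℕ) : Prop :=
  ∃ i ≤ r, n i = 2 ∧ ∀ t, i < t → t ≤ r → n t < 5

theorem alive_or_alive_succ {n : ℕ → ℕ} {g : ℕ → ℕ → ℕ → ℕ} {r : ℕ}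
    (h : ∀ l l', ∃ u, Alive n g r u l ∧ Alive n g r u l') (l : ℕ) {v v' : ℕ}
    (hv : v < n (r + 1)) (hv' : v' < n (r + 1)) (hne : v ≠ v') :
    Alive n g (r + 1) v l ∨ Alive n g (r + 1) v' l := by
  obtain ⟨u, h1, h2⟩ := h v v'
  by_cases hg : v = g (r + 1) u l
  · exact Or.inr ⟨hv', u, h2, fun h => hne (hg.trans h.symm)⟩
  · exact Or.inl ⟨hv, u, h1, hg⟩

/-- Each of `l` and `l'` spoils at most one of the colors `0, 1, 2`. -/
theorem exists_alive_alive {n : ℕ → ℕ} {g : ℕ → ℕ → ℕ → ℕ} {r : ℕ} (hn : 3 ≤ n r)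
    (h : ∀ l v v', v < n r → v' < n r → v ≠ v' → Alive n g r v l ∨ Alive n g r v' l) (l l' : ℕ) :
    ∃ u, Alive n g r u l ∧ Alive n g r u l' := by
  have a1 := h l 0 1 (by omega) (by omega) (by omega)
  have a2 := h l 0 2 (by omega) (by omega) (by omega)
  have a3 := h l 1 2 (by omega) (by omega) (by omega)
  have b1 := h l' 0 1 (by omega) (by omega) (by omega)
  have b2 := h l' 0 2 (by omega) (by omega) (by omega)
  have b3 := h l' 1 2 (by omega) (by omega) (by omega)
  by_cases c0 : Alive n g r 0 l ∧ Alive n g r 0 l'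
  · exact ⟨0, c0⟩
  by_cases c1 : Alive n g r 1 l ∧ Alive n g r 1 l'
  · exact ⟨1, c1⟩
  exact ⟨2, by tauto⟩

theorem exists_lt_five_ne (a b c d : ℕ) : ∃ x < 5, x ≠ a ∧ x ≠ b ∧ x ≠ c ∧ x ≠ d := by
  have : (Finset.range 5 \ {a, b, c, d}).Nonempty := by
    rw [← Finset.card_pos]
    have h1 := Finset.le_card_sdiff {a, b, c, d} (Finset.range 5)
    have h2 : ({a, b, c, d} : Finset ℕ).card ≤ 4 := Finset.card_le_four
    simp only [Finset.card_range] at h1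
    omega
  obtain ⟨x, hx⟩ := this
  simp only [Finset.mem_sdiff, Finset.mem_range, Finset.mem_insert, Finset.mem_singleton,
    not_or] at hx
  exact ⟨x, hx.1, hx.2⟩

/-- On a path without two vertices of hatness two that are separated by small hatnesses only, two
colors suffice for the last vertex, and any two colors of the next vertex are compatible with
a common color if there is no vertex of hatness two after the last one of hatness at
least five. -/
theorem alive_invariant (n : ℕ → ℕ) (g : ℕ → ℕ → ℕ → ℕ) (r : ℕ) (hn : ∀ i ≤ r, 2 ≤ n i)
    (hs : ∀ i < r, TwoOpen n i → n (i + 1) ≠ 2) :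
    (∃ a b, ∀ l, Alive n g r a l ∨ Alive n g r b l) ∧
      (¬ TwoOpen n r → ∀ l l', ∃ u, Alive n g r u l ∧ Alive n g r u l') := by
  have key : ∀ r, 2 ≤ n r →
      (∀ l v v', v < n r → v' < n r → v ≠ v' → Alive n g r v l ∨ Alive n g r v' l) →
      (∃ a b, ∀ l, Alive n g r a l ∨ Alive n g r b l) ∧
      (¬ TwoOpen n r → ∀ l l', ∃ u, Alive n g r u l ∧ Alive n g r u l') := by
    intro r hr h
    refine ⟨⟨0, 1, fun l => h l 0 1 (by omega) (by omega) (by omega)⟩, fun ht => ?_⟩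
    refine exists_alive_alive ?_ h
    by_contra hlt
    exact ht ⟨r, le_rfl, by omega, fun t h1 h2 => by omega⟩
  induction r with
  | zero =>
    refine key 0 (hn 0 le_rfl) fun l v v' hv hv' hne => ?_
    by_cases hg : v = g 0 0 l
    · exact Or.inr ⟨hv', fun h => hne (hg.trans h.symm)⟩
    · exact Or.inl ⟨hv, hg⟩
  | succ r ih =>
    obtain ⟨⟨a, b, hab⟩, hc⟩ := ih (fun i hi => hn i (by omega)) (fun i hi => hs i (by omega))
    by_cases ht : TwoOpen n r
    · have h3 : 3 ≤ n (r + 1) := by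
        have := hn (r + 1) le_rfl
        have := hs r (by omega) ht
        omega
      have share : ∀ u v v', v < n (r + 1) → v' < n (r + 1) → v ≠ v' → Alive n g r u v →
          Alive n g r u v' → ∀ l, Alive n g (r + 1) v l ∨ Alive n g (r + 1) v' l := by
        intro u v v' hv hv' hne h1 h2 l
        by_cases hg : v = g (r + 1) u l
        · exact Or.inr ⟨hv', u, h2, fun h => hne (hg.trans h.symm)⟩
        · exact Or.inl ⟨hv, u, h1, hg⟩
      have s01 := fun u => share u 0 1 (by omega) (by omega) (by omega)
      have s02 := fun u => share u 0 2 (by omega) (by omega) (by omega)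
      have s12 := fun u => share u 1 2 (by omega) (by omega) (by omega)
      refine ⟨?_, fun ht' l l' => ?_⟩
      -- By pigeonhole, two of the colors `0, 1, 2` are supported by the same one of `a`, `b`; they
      -- form the new pair.
      · rcases hab 0 with h0 | h0 <;> rcases hab 1 with h1 | h1 <;> rcases hab 2 with h2 | h2
        · exact ⟨0, 1, s01 _ h0 h1⟩
        · exact ⟨0, 1, s01 _ h0 h1⟩
        · exact ⟨0, 2, s02 _ h0 h2⟩
        · exact ⟨1, 2, s12 _ h1 h2⟩
        · exact ⟨1, 2, s12 _ h1 h2⟩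
        · exact ⟨0, 2, s02 _ h0 h2⟩
        · exact ⟨0, 1, s01 _ h0 h1⟩
        · exact ⟨0, 1, s01 _ h0 h1⟩
      · have h5 : 5 ≤ n (r + 1) := by
          by_contra hlt
          obtain ⟨i, hi, h2, h⟩ := ht
          refine ht' ⟨i, by omega, h2, fun t h1 h2 => ?_⟩
          rcases Nat.lt_or_eq_of_le h2 with h3 | rfl
          · exact h t h1 (by omega)
          · omega
        obtain ⟨x, hx, h1, h2, h3, h4⟩ := exists_lt_five_ne (g (r + 1) a l) (g (r + 1) b l)
          (g (r + 1) a l') (g (r + 1) b l')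
        rcases hab x with h | h
        · exact ⟨x, ⟨by omega, a, h, h1⟩, ⟨by omega, a, h, h3⟩⟩
        · exact ⟨x, ⟨by omega, b, h, h2⟩, ⟨by omega, b, h, h4⟩⟩
    · exact key (r + 1) (hn _ le_rfl) fun l v v' hv hv' hne =>
        alive_or_alive_succ (hc ht) l hv hv' hne

/-! ### Closing the coloring up around the cycle -/

/-- All but one of the values of a function are avoided by it at two of the points `0, 1, 2`. -/
theorem exists_majority (φ : ℕ → ℕ) :
    ∃ m, ∀ v, v ≠ m → ∃ s t, s < 3 ∧ t < 3 ∧ s ≠ t ∧ φ s ≠ v ∧ φ t ≠ v := by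
  by_cases h01 : φ 0 = φ 1
  · exact ⟨φ 0, fun v hv => ⟨0, 1, by omega, by omega, by omega, by omega, by omega⟩⟩
  by_cases h02 : φ 0 = φ 2
  · exact ⟨φ 0, fun v hv => ⟨0, 2, by omega, by omega, by omega, by omega, by omega⟩⟩
  refine ⟨φ 1, fun v hv => ?_⟩
  by_cases h0 : φ 0 = v
  · exact ⟨1, 2, by omega, by omega, by omega, by omega, by omega⟩
  · exact ⟨0, 1, by omega, by omega, by omega, by omega, by omega⟩

/-- A coloring of the cycle `0, …, N` (of natural number colors) for which nobody guesses right. -/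
def Disproves (N : ℕ) (n : ℕ → ℕ) (g : ℕ → ℕ → ℕ → ℕ) (c : ℕ → ℕ) : Prop :=
  (∀ i ≤ N, c i < n i) ∧ c 0 ≠ g 0 (c N) (c 1) ∧
    (∀ i, i + 1 < N → c (i + 1) ≠ g (i + 1) (c i) (c (i + 2))) ∧ c N ≠ g N (c (N - 1)) (c 0)

/-- Any two of the vertices `0, …, N - 1` of hatness two have a vertex of hatness at least five in
between. -/
def TwosSeparated (N : ℕ) (n : ℕ → ℕ) : Prop :=
  ∀ i j, i < j → j < N → n i = 2 → n j = 2 → ∃ t, i < t ∧ t < j ∧ 5 ≤ n t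

theorem TwosSeparated.not_twoOpen {N : ℕ} {n : ℕ → ℕ} (h : TwosSeparated N n) {r : ℕ}
    (hr : r + 1 < N) (h2 : n (r + 1) = 2) : ¬ TwoOpen n r := by
  rintro ⟨i, hi, hi2, hlt⟩
  obtain ⟨t, h1, h3, h5⟩ := h i (r + 1) (by omega) hr hi2 h2
  have := hlt t h1 (by omega)
  omega

theorem TwosSeparated.shift {N : ℕ} {n : ℕ → ℕ} (h : TwosSeparated N n) :
    TwosSeparated (N - 1) (fun i => n (i + 1)) := by
  intro i j hij hj hi2 hj2
  obtain ⟨t, h1, h2, h3⟩ := h (i + 1) (j + 1) (by omega) (by omega) hi2 hj2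
  refine ⟨t - 1, by omega, by omega, ?_⟩
  beta_reduce
  rwa [Nat.sub_add_cancel (by omega)]

theorem TwosSeparated.mirror {N : ℕ} {n : ℕ → ℕ} (h : TwosSeparated N n) :
    TwosSeparated N (fun i => if i < N then n (N - 1 - i) else n i) := by
  intro i j hij hj hi2 hj2
  dsimp only at hi2 hj2 ⊢
  rw [if_pos (by omega)] at hi2 hj2
  obtain ⟨t, h1, h2, h3⟩ := h (N - 1 - j) (N - 1 - i) (by omega) (by omega) hj2 hi2
  refine ⟨N - 1 - t, by omega, by omega, ?_⟩
  rw [if_pos (by omega), show N - 1 - (N - 1 - t) = t by omega]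
  exact h3

theorem Disproves.mirror {N : ℕ} {n : ℕ → ℕ} {g : ℕ → ℕ → ℕ → ℕ} {c : ℕ → ℕ} (hN : 3 ≤ N)
    (h : Disproves N (fun i => if i < N then n (N - 1 - i) else n i)
      (fun i l r => if i < N then g (N - 1 - i) r l else g i r l) c) :
    Disproves N n g (fun i => if i < N then c (N - 1 - i) else c i) := by
  obtain ⟨h1, h2, h3, h4⟩ := h
  obtain ⟨M, rfl⟩ : ∃ M, N = M + 3 := ⟨N - 3, by omega⟩
  refine ⟨fun i hi => ?_, ?_, fun i hi => ?_, ?_⟩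
  · by_cases hlt : i < M + 3
    · have := h1 (M + 3 - 1 - i) (by omega)
      beta_reduce at this
      rw [if_pos (by omega), show M + 3 - 1 - (M + 3 - 1 - i) = i by omega] at this
      simpa [hlt] using this
    · have := h1 i hi
      simpa [hlt] using this
  · have := h3 (M + 1) (by omega)
    simpa using this
  · rcases Nat.lt_or_eq_of_le (Nat.le_of_lt_succ hi) with hi' | hi'
    · have := h3 (M - i) (by omega)
      beta_reduce at this ⊢
      rw [if_pos (by omega)] at this
      rw [if_pos (by omega), if_pos (by omega), if_pos (by omega)]
      rw [show M + 3 - 1 - (M - i + 1) = i + 1 by omega] at this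
      rwa [show M + 3 - 1 - (i + 1) = M - i + 1 by omega, show M + 3 - 1 - i = M - i + 2 by omega,
        show M + 3 - 1 - (i + 2) = M - i by omega]
    · obtain rfl : i = M + 1 := by omega
      simpa using h2
  · simpa using h4

/-- Gluing with a shifted index: `c i` colors vertex `i + 1`, while `w` and `x` color the vertices
`0` and `M + 3`. -/
theorem exists_disproves_of_interior {M : ℕ} {n : ℕ → ℕ} {g : ℕ → ℕ → ℕ → ℕ} {c : ℕ → ℕ}
    {w x : ℕ} (hw : w < n 0) (hc : ∀ i ≤ M + 1, c i < n (i + 1)) (hx : x < n (M + 3))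
    (h0 : w ≠ g 0 x (c 0)) (h1 : c 0 ≠ g 1 w (c 1))
    (h2 : ∀ i < M, c (i + 1) ≠ g (i + 2) (c i) (c (i + 2)))
    (h3 : c (M + 1) ≠ g (M + 2) (c M) x) (h4 : x ≠ g (M + 3) (c (M + 1)) w) :
    ∃ c, Disproves (M + 3) n g c := by
  have e1 : ∀ i ≤ M + 1, (if i ≤ M + 1 then c i else x) = c i := fun i hi => if_pos hi
  have e2 : (if M + 2 ≤ M + 1 then c (M + 2) else x) = x := if_neg (by omega)
  refine ⟨fun i => match i with
    | 0 => w
    | i + 1 => if i ≤ M + 1 then c i else x, fun i hi => ?_, ?_, fun i hi => ?_, ?_⟩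
  · match i with
    | 0 => exact hw
    | i + 1 =>
      rcases Nat.lt_or_ge (M + 1) i with h | h
      · obtain rfl : i = M + 2 := by omega
        simpa [e2] using hx
      · simpa [h] using hc i h
  · simpa [e1, e2] using h0
  · match i with
    | 0 => simpa [e1] using h1
    | i + 1 =>
      rcases Nat.lt_or_ge i M with h | h
      · have := h2 i h
        dsimp only
        rwa [if_pos (by omega), if_pos (by omega), if_pos (by omega)]
      · obtain rfl : i = M := by omega
        dsimp only
        rwa [if_pos (by omega), if_pos (by omega), if_neg (by omega)]
  · simpa [e1, e2] using h4

/-- The color `x` beats every guess possible at `M + 3`, whose neighbors have two colors each. With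
`x` fixed, only a path is left. -/
theorem exists_disproves_of_two_two {M : ℕ} {n : ℕ → ℕ} (g : ℕ → ℕ → ℕ → ℕ)
    (hn : ∀ i < M + 3, 2 ≤ n i) (hN : 5 ≤ n (M + 3)) (hs : TwosSeparated (M + 3) n)
    (h0 : n 0 = 2) (h1 : n (M + 2) = 2) : ∃ c, Disproves (M + 3) n g c := by
  obtain ⟨x, hx, x1, x2, x3, x4⟩ := exists_lt_five_ne (g (M + 3) 0 0) (g (M + 3) 0 1)
    (g (M + 3) 1 0) (g (M + 3) 1 1)
  obtain ⟨a, b, hab⟩ := (alive_invariant n (fun i l r => if i = 0 then g 0 x r else g i l r)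
    (M + 2) (fun i hi => hn i (by omega))
    (fun i hi ht h2 => hs.not_twoOpen (by omega) h2 ht)).1
  obtain ⟨v, hv⟩ : ∃ v, Alive n (fun i l r => if i = 0 then g 0 x r else g i l r) (M + 2) v x := by
    rcases hab x with h | h
    exacts [⟨a, h⟩, ⟨b, h⟩]
  obtain ⟨c, c1, c2, c3, c4, c5⟩ := hv.exists_coloring
  refine ⟨c, fun i hi => ?_, ?_, fun i hi => ?_, ?_⟩
  · rcases Nat.lt_or_eq_of_le hi with hi | rfl
    · exact c3 i (by omega)
    · rw [c1]
      omega
  · rw [c1]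
    simpa using c4
  · simpa using c5 i (by omega)
  · have b0 := c3 0 (by omega)
    have b1 := c3 (M + 2) (by omega)
    have e0 : c 0 = 0 ∨ c 0 = 1 := by omega
    have e1 : c (M + 2) = 0 ∨ c (M + 2) = 1 := by omega
    rw [c1, show M + 3 - 1 = M + 2 from rfl]
    rcases e0 with e0 | e0 <;> rcases e1 with e1 | e1 <;> rw [e0, e1] <;> assumption

/-- Both colors `p` of vertex `M + 2` are supported by a common color `v` of `M + 1`, and each `p`
comes with two candidates for vertex `0`. Once `x` beats the four resulting guesses, the single
guess of `M + 2` on seeing `v` and `x` spares one `p`. -/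
theorem exists_disproves_of_three_two {M : ℕ} {n : ℕ → ℕ} (g : ℕ → ℕ → ℕ → ℕ)
    (hn : ∀ i < M + 3, 2 ≤ n i) (hN : 5 ≤ n (M + 3)) (hs : TwosSeparated (M + 3) n)
    (h0 : 3 ≤ n 0) (h1 : n (M + 2) = 2) : ∃ c, Disproves (M + 3) n g c := by
  choose m hm using fun r => exists_majority (fun t => g 1 t r)
  set g' : ℕ → ℕ → ℕ → ℕ := fun i l r => if i = 0 then m r else g (i + 1) l r with hg'
  obtain ⟨v, hv0, hv1⟩ := (alive_invariant (fun i => n (i + 1)) g' M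
    (fun i hi => hn (i + 1) (by omega))
    (fun i hi ht h2 => hs.shift.not_twoOpen (by omega) h2 ht)).2
    (hs.shift.not_twoOpen (by omega) h1) 0 1
  have main : ∀ p, p < 2 → Alive (fun i => n (i + 1)) g' M v p →
      ∃ s t, ∀ x < 5, x ≠ g (M + 3) p s → x ≠ g (M + 3) p t → p ≠ g (M + 2) v x →
        ∃ c, Disproves (M + 3) n g c := by
    intro p hp h
    obtain ⟨c, c1, c2, c3, c4, c5⟩ := h.exists_coloring
    obtain ⟨s, t, hs3, ht3, hst, hs', ht'⟩ := hm (c 1) (c 0) (by simpa [hg'] using c4)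
    have key : ∀ w x, x < 5 → w < 3 → g 1 w (c 1) ≠ c 0 → w ≠ g 0 x (c 0) →
        x ≠ g (M + 3) p w → p ≠ g (M + 2) v x → ∃ c, Disproves (M + 3) n g c := by
      intro w x hx hw k1 k2 k3 k4
      refine exists_disproves_of_interior (c := c) (w := w) (x := x) (by omega) (fun i hi => ?_)
        (by omega) k2 k1.symm (fun i hi => by simpa [hg'] using c5 i hi) (by rwa [c1, c2])
        (by rwa [c1])
      rcases Nat.lt_or_eq_of_le hi with hi | rfl
      · exact c3 i (by omega)
      · rw [c1, h1]
        exact hp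
    refine ⟨s, t, fun x hx x1 x2 x3 => ?_⟩
    by_cases hw : s = g 0 x (c 0)
    · exact key t x hx ht3 ht' (by omega) x2 x3
    · exact key s x hx hs3 hs' hw x1 x3
  obtain ⟨s, t, H0⟩ := main 0 (by omega) hv0
  obtain ⟨s', t', H1⟩ := main 1 (by omega) hv1
  obtain ⟨x, hx, x1, x2, x3, x4⟩ := exists_lt_five_ne (g (M + 3) 0 s) (g (M + 3) 0 t)
    (g (M + 3) 1 s') (g (M + 3) 1 t')
  by_cases hp : 0 = g (M + 2) v x
  · exact H1 x hx x3 x4 (by omega)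
  · exact H0 x hx x1 x2 hp

theorem exists_disproves_of_three_three {M : ℕ} {n : ℕ → ℕ} (g : ℕ → ℕ → ℕ → ℕ)
    (hn : ∀ i < M + 4, 2 ≤ n i) (hN : 5 ≤ n (M + 4)) (hs : TwosSeparated (M + 4) n)
    (h0 : 3 ≤ n 0) (h1 : 3 ≤ n (M + 3)) : ∃ c, Disproves (M + 4) n g c := by
  choose m hm using fun r => exists_majority (fun t => g 1 t r)
  choose m' hm' using fun l => exists_majority (fun t => g (M + 2) l t)
  set g' : ℕ → ℕ → ℕ → ℕ := fun i l r =>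
    if i = 0 then m r else if i = M + 1 then m' l else g (i + 1) l r with hg'
  obtain ⟨v, v', hv⟩ := (alive_invariant (fun i => n (i + 1)) g' (M + 1)
    (fun i hi => hn (i + 1) (by omega))
    (fun i hi ht h2 => hs.shift.not_twoOpen (by omega) h2 ht)).1
  -- The right color `0` is a dummy: the majority guess of the last vertex ignores it.
  obtain ⟨v, hv⟩ : ∃ v, Alive (fun i => n (i + 1)) g' (M + 1) v 0 := by
    rcases hv 0 with h | h
    exacts [⟨v, h⟩, ⟨v', h⟩]
  obtain ⟨c, c1, c2, c3, c4, c5⟩ := hv.exists_coloring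
  obtain ⟨s, t, hs3, ht3, hst, hs', ht'⟩ := hm (c 1) (c 0) (by simpa [hg'] using c4)
  obtain ⟨σ, τ, hσ3, hτ3, hστ, hσ', hτ'⟩ := hm' (c M) (c (M + 1))
    (by simpa [hg'] using c5 M (by omega))
  obtain ⟨x, hx, x1, x2, x3, x4⟩ := exists_lt_five_ne (g (M + 4) σ s) (g (M + 4) σ t)
    (g (M + 4) τ s) (g (M + 4) τ t)
  have key : ∀ w u, w < 3 → u < 3 → g 1 w (c 1) ≠ c 0 → g (M + 2) (c M) u ≠ c (M + 1) →
      w ≠ g 0 x (c 0) → u ≠ g (M + 3) (c (M + 1)) x → x ≠ g (M + 4) u w →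
      ∃ c, Disproves (M + 4) n g c := by
    intro w u hw hu k1 k2 k3 k4 k5
    have e1 : ∀ i ≤ M + 1, (if i ≤ M + 1 then c i else u) = c i := fun i hi => if_pos hi
    have e2 : (if M + 1 + 1 ≤ M + 1 then c (M + 1 + 1) else u) = u := if_neg (by omega)
    refine exists_disproves_of_interior (M := M + 1) (c := fun i => if i ≤ M + 1 then c i else u)
      (w := w) (x := x) (by omega) (fun i hi => ?_) (hx.trans_le hN) (by simpa [e1] using k3)
      (by simpa [e1] using k1.symm) (fun i hi => ?_) ?_ ?_
    · rcases Nat.lt_or_eq_of_le hi with hi | rfl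
      · have := c3 i (by omega)
        simpa [e1 i (by omega)] using this
      · simp only [e2]
        exact hu.trans_le h1
    · rcases Nat.lt_or_eq_of_le (Nat.le_of_lt_succ hi) with hi | rfl
      · have := c5 i (by omega)
        simp only [e1 i (by omega), e1 (i + 1) (by omega), e1 (i + 2) (by omega)]
        simpa [hg', show i ≠ M by omega] using this
      · simp only [e1 i (by omega), e1 (i + 1) (by omega), e2]
        exact k2.symm
    · simp only [e1 (M + 1) le_rfl, e2]
      exact k4
    · simp only [e2]
      exact k5
  by_cases hw : s = g 0 x (c 0) <;> by_cases hu : σ = g (M + 3) (c (M + 1)) x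
  · exact key t τ ht3 hτ3 ht' hτ' (by omega) (by omega) x4
  · exact key t σ ht3 hσ3 ht' hσ' (by omega) (by omega) x2
  · exact key s τ hs3 hτ3 hs' hτ' (by omega) (by omega) x3
  · exact key s σ hs3 hσ3 hs' hσ' (by omega) (by omega) x1

theorem exists_pair_lt_three_ne (a : ℕ) : ∃ s t, s < 3 ∧ t < 3 ∧ s ≠ t ∧ s ≠ a ∧ t ≠ a := by
  by_cases h0 : a = 0
  · exact ⟨1, 2, by omega⟩
  by_cases h1 : a = 1
  · exact ⟨0, 2, by omega⟩
  · exact ⟨0, 1, by omega⟩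

/-- Vertex `1` sees both neighbors of `3`. Either its guess is constant on some 2×2 rectangle of
their colors, and its other color leaves two candidates on each side, or ten pairs of colors of `3`
and `1` inject into nine pairs of colors of `0` and `2`. -/
theorem exists_disproves_square {n : ℕ → ℕ} (g : ℕ → ℕ → ℕ → ℕ) (h0 : 3 ≤ n 0) (h1 : 2 ≤ n 1)
    (h2 : 3 ≤ n 2) (h3 : 5 ≤ n 3) : ∃ c, Disproves 3 n g c := by
  have key : ∀ w p u x, w < 3 → p < 2 → u < 3 → x < 5 → w ≠ g 0 x p → p ≠ g 1 w u →
      u ≠ g 2 p x → x ≠ g 3 u w → ∃ c, Disproves 3 n g c := by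
    intro w p u x hw hp hu hx k0 k1 k2 k3
    refine exists_disproves_of_interior (M := 0) (c := fun i => if i = 0 then p else u) (w := w)
      (x := x) (by omega) (fun i hi => ?_) (hx.trans_le h3) (by simpa using k0) (by simpa using k1)
      (by simp) (by simpa using k2) (by simpa using k3)
    obtain rfl | rfl : i = 0 ∨ i = 1 := by omega
    · exact hp.trans_le h1
    · exact hu.trans_le h2
  by_contra hno
  -- `min _ 1` counts every nonzero guess as `1`.
  by_cases hrect : ∃ x p, p < 2 ∧
      ∀ w u, w < 3 → u < 3 → w ≠ g 0 x p → u ≠ g 2 p x → min (g 1 w u) 1 = p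
  · obtain ⟨y, p, hp, hr⟩ := hrect
    obtain ⟨s, t, hs, ht, hst, hs', ht'⟩ := exists_pair_lt_three_ne (g 0 y p)
    obtain ⟨σ, τ, hσ, hτ, hστ, hσ', hτ'⟩ := exists_pair_lt_three_ne (g 2 p y)
    obtain ⟨x, hx, x1, x2, x3, x4⟩ := exists_lt_five_ne (g 3 σ s) (g 3 σ t) (g 3 τ s) (g 3 τ t)
    have conv : ∀ w u, min (g 1 w u) 1 = p → 1 - p ≠ g 1 w u := fun w u h => by omega
    have r1 := conv _ _ (hr s σ hs hσ hs' hσ')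
    have r2 := conv _ _ (hr t σ ht hσ ht' hσ')
    have r3 := conv _ _ (hr s τ hs hτ hs' hτ')
    have r4 := conv _ _ (hr t τ ht hτ ht' hτ')
    have hq : 1 - p < 2 := by omega
    apply hno
    by_cases hw : s = g 0 x (1 - p) <;> by_cases hu : σ = g 2 (1 - p) x
    · exact key t (1 - p) τ x ht hq hτ hx (fun h => hst (hw.trans h.symm)) r4
        (fun h => hστ (hu.trans h.symm)) x4
    · exact key t (1 - p) σ x ht hq hσ hx (fun h => hst (hw.trans h.symm)) r2 hu x2
    · exact key s (1 - p) τ x hs hq hτ hx hw r3 (fun h => hστ (hu.trans h.symm)) x3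
    · exact key s (1 - p) σ x hs hq hσ hx hw r1 hu x1
  · push Not at hrect
    have H : ∀ y : Fin 5 × Fin 2, ∃ z : Fin 3 × Fin 3,
        min (g 1 z.1 z.2) 1 ≠ (y.2 : ℕ) ∧ g 3 z.2 z.1 = (y.1 : ℕ) := by
      rintro ⟨x, p⟩
      obtain ⟨w, u, hw, hu, k1, k2, k3⟩ := hrect x p p.2
      refine ⟨(⟨w, hw⟩, ⟨u, hu⟩), k3, ?_⟩
      by_contra hx
      exact hno (key w p u x hw p.2 hu x.2 k1 (by have := p.2; omega) k2 (Ne.symm hx))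
    -- `F` is injective: its value determines `x` as the guess of `3`, and `p` as the bit that
    -- vertex `1` does not guess.
    choose F hF1 hF2 using H
    have hinj : Function.Injective F := by
      rintro ⟨x, p⟩ ⟨x', p'⟩ he
      have a1 := hF1 (x, p)
      have a2 := hF1 (x', p')
      have b1 := hF2 (x, p)
      have b2 := hF2 (x', p')
      rw [he] at a1 b1
      simp only at a1 a2 b1 b2
      refine Prod.ext (Fin.ext (by simp only; omega)) (Fin.ext ?_)
      have := p.2
      have := p'.2
      simp only
      omega
    have := Fintype.card_le_of_injective F hinj
    simp at this

/-- A cycle with a vertex of hatness at least five, on which any two vertices of hatness two are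
separated by that vertex on one side and by a vertex of hatness at least five on the other side,
has a disproving coloring. -/
theorem exists_disproves {N : ℕ} (h3 : 3 ≤ N) {n : ℕ → ℕ} (g : ℕ → ℕ → ℕ → ℕ)
    (hn : ∀ i < N, 2 ≤ n i) (hN : 5 ≤ n N) (hs : TwosSeparated N n) :
    ∃ c, Disproves N n g c := by
  obtain ⟨M, rfl⟩ : ∃ M, N = M + 3 := ⟨N - 3, by omega⟩
  have a0 := hn 0 (by omega)
  have a1 := hn (M + 2) (by omega)
  by_cases h0 : n 0 = 2 <;> by_cases h1 : n (M + 2) = 2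
  · exact exists_disproves_of_two_two g hn hN hs h0 h1
  · obtain ⟨c, hc⟩ := exists_disproves_of_three_two
      (n := fun i => if i < M + 3 then n (M + 3 - 1 - i) else n i)
      (fun i l r => if i < M + 3 then g (M + 3 - 1 - i) r l else g i r l)
      (fun i hi => by simpa [hi] using hn (M + 3 - 1 - i) (by omega)) (by simpa using hN) hs.mirror
      (by simp only [Nat.zero_lt_succ, if_true]; change 3 ≤ n (M + 2); omega) (by simpa using h0)
    exact ⟨_, hc.mirror (by omega)⟩
  · exact exists_disproves_of_three_two g hn hN hs (by omega) h1
  · rcases Nat.eq_zero_or_pos M with rfl | hM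
    · exact exists_disproves_square g (by omega) (hn 1 (by omega)) (lt_of_le_of_ne a1 (Ne.symm h1)) hN
    · obtain ⟨L, rfl⟩ : ∃ L, M = L + 1 := ⟨M - 1, by omega⟩
      exact exists_disproves_of_three_three g hn hN hs (by omega) (lt_of_le_of_ne a1 (Ne.symm h1))

/-! ### Winning strategies on paths -/

namespace LatvianGame

/-- A path of hatness `2, 3 or 4, …, 3 or 4, 2` wins: a color of an inner vertex consists of two
bits, one for each edge, and on each edge exactly one end guesses its bit. -/
theorem winnable_of_path {V : Type*} (G : LatvianGame V) (hG : ∀ v, 2 ≤ G.hatness v) {L : ℕ}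
    (hL : 1 ≤ L) (v : ℕ → V) (hinj : Set.InjOn v {i | i ≤ L})
    (hadj : ∀ i < L, G.graph.Adj (v i) (v (i + 1))) (h0 : G.hatness (v 0) = 2)
    (h1 : G.hatness (v L) = 2) (h4 : ∀ i, 0 < i → i < L → G.hatness (v i) ≤ 4) :
    G.Winnable := by
  classical
  set leftBit : ℕ → ℕ → ℕ := fun j x => if j = L then x else x / 2 with hlb
  -- The left end of an edge bets that the two bits on it agree, the right end that they differ.
  set guess : ℕ → ℕ → ℕ → ℕ := fun i l r =>
    (if i = 0 then 0 else if i = L then 1 - l % 2 else 2 * (1 - l % 2)) +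
      if i = L then 0 else leftBit (i + 1) r with hguess
  set idx : V → ℕ := Function.invFunOn v {i | i ≤ L} with hidx
  have idx_v : ∀ i ≤ L, idx (v i) = i := fun i hi => hinj.leftInvOn_invFunOn hi
  set f : G.Strategy := fun w nb =>
    have val : V → ℕ := fun u => if hu : u ∈ G.graph.neighborSet w then nb ⟨u, hu⟩ else 0
    ⟨guess (idx w) (val (v (idx w - 1))) (val (v (idx w + 1))) % G.hatness w,
      Nat.mod_lt _ (by have := hG w; omega)⟩ with hf
  refine ⟨f, fun c => ?_⟩
  have right : ∀ i ≤ L, (∀ l r, (0 < i → l = (c (v (i - 1)) : ℕ)) →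
      (i < L → r = (c (v (i + 1)) : ℕ)) → guess i l r = c (v i)) → G.GuessesRight f c (v i) := by
    intro i hi h
    refine Fin.ext ?_
    simp only [hf, idx_v i hi]
    rw [h, Nat.mod_eq_of_lt (c (v i)).2]
    · intro hi0
      have := hadj (i - 1) (by omega)
      rw [Nat.sub_add_cancel hi0] at this
      rw [dif_pos (show v (i - 1) ∈ G.graph.neighborSet (v i) from this.symm)]
      rw [idx_v i hi]
    · intro hiL
      rw [dif_pos (show v (i + 1) ∈ G.graph.neighborSet (v i) from hadj i hiL)]
      rw [idx_v i hi]
  -- At the first edge whose bits agree, the left end is right about both of its edges; if there is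
  -- none, the last vertex is right.
  have hex : ∃ i, i = L ∨ (c (v i) : ℕ) % 2 = leftBit (i + 1) (c (v (i + 1))) := ⟨L, Or.inl rfl⟩
  set i := Nat.find hex with hi
  have hiL : i ≤ L := Nat.find_min' hex (Or.inl rfl)
  have hspec := Nat.find_spec hex
  rw [← hi] at hspec
  have b0 : (c (v 0) : ℕ) < 2 := h0 ▸ (c (v 0)).2
  have bL : (c (v L) : ℕ) < 2 := h1 ▸ (c (v L)).2
  refine ⟨v i, right i hiL fun l r hl hr => ?_⟩
  have hleft : 0 < i → (c (v (i - 1)) : ℕ) % 2 ≠ leftBit i (c (v i)) := by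
    intro h
    have := Nat.find_min hex (show i - 1 < Nat.find hex by omega)
    rw [not_or, Nat.sub_add_cancel h] at this
    exact this.2
  by_cases hi0 : i = 0
  · rw [hi0] at hspec hr ⊢
    have hs := hspec.resolve_left (by omega)
    rw [hr (by omega)]
    simp only [hguess, if_true, if_neg (show 0 ≠ L by omega)]
    omega
  · have hl := hl (by omega)
    have hne := hleft (by omega)
    rw [← hl] at hne
    by_cases hiL' : i = L
    · rw [hiL'] at hne ⊢
      simp only [hlb, if_true] at hne
      simp only [hguess, if_true, if_neg (show L ≠ 0 by omega)]
      omega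
    · have hs := hspec.resolve_left hiL'
      have := h4 i (by omega) (by omega)
      have := (c (v i)).2
      rw [hr (by omega)]
      simp only [hlb, if_neg hiL'] at hne
      simp only [hguess, if_neg hi0, if_neg hiL']
      rw [← hs]
      omega

theorem Winnable.of_delete {V : Type*} {G : LatvianGame V} {a : V} (hG : 0 < G.hatness a)
    (h : (G.delete a).Winnable) : G.Winnable := by
  classical
  obtain ⟨f, hf⟩ := h
  refine ⟨fun v nb => if hv : v = a then ⟨0, by rwa [hv]⟩ else
    f ⟨v, hv⟩ fun u => nb ⟨u.1.1, u.2⟩, fun c => ?_⟩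
  obtain ⟨⟨v, hv⟩, hg⟩ := hf fun u => c u.1
  refine ⟨v, ?_⟩
  have hv' : v ≠ a := hv
  exact (dif_neg hv').trans hg

theorem exists_walk_support {V : Type*} {G : SimpleGraph V} (v : ℕ → V) (d : ℕ)
    (hadj : ∀ i < d, G.Adj (v i) (v (i + 1))) :
    ∃ p : G.Walk (v 0) (v d), p.support = (List.range (d + 1)).map v := by
  induction d with
  | zero => exact ⟨.nil, by simp⟩
  | succ d ih =>
    obtain ⟨p, hp⟩ := ih fun i hi => hadj i (by omega)
    refine ⟨p.concat (hadj d (by omega)), ?_⟩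
    rw [SimpleGraph.Walk.support_concat, hp, List.range_succ (n := d + 1), List.map_append]
    simp

theorem containsHatnessSequence_of_path {V : Type*} (G : LatvianGame V) (v : ℕ → V) (m : ℕ)
    (hadj : ∀ i < m + 1, G.graph.Adj (v i) (v (i + 1))) (hinj : Set.InjOn v {i | i ≤ m + 1}) :
    G.ContainsHatnessSequence (G.hatness (v 0) ::
      ((List.range m).map (fun i => G.hatness (v (i + 1))) ++ [G.hatness (v (m + 1))])) := by
  obtain ⟨p, hp⟩ := exists_walk_support v (m + 1) hadj
  refine ⟨_, _, p, ?_, ?_⟩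
  · rw [SimpleGraph.Walk.isPath_def, hp]
    refine List.Nodup.map_on (fun x hx y hy h => hinj ?_ ?_ h) List.nodup_range
    · simpa [Nat.lt_succ_iff] using hx
    · simpa [Nat.lt_succ_iff] using hy
  · rw [hp, List.range_succ_eq_map, List.range_succ]
    simp [Function.comp_def]

theorem ContainsHatnessSequence.exists_path {V : Type*} {G : LatvianGame V} {cs : List ℕ}
    (h : G.ContainsHatnessSequence (2 :: (cs ++ [2]))) :
    ∃ v : ℕ → V, Set.InjOn v {i | i ≤ cs.length + 1} ∧
      (∀ i < cs.length + 1, G.graph.Adj (v i) (v (i + 1))) ∧ G.hatness (v 0) = 2 ∧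
      G.hatness (v (cs.length + 1)) = 2 ∧
      ∀ i, 0 < i → i < cs.length + 1 → G.hatness (v i) ∈ cs := by
  obtain ⟨u, w, p, hp, hl⟩ := h
  have hlen : p.length = cs.length + 1 := by
    have := congrArg List.length hl
    simpa using this
  have hget : ∀ i, (hi : i < cs.length + 2) →
      G.hatness (p.getVert i) = (2 :: (cs ++ [2]))[i]'(by simp; omega) := by
    intro i hi
    simp only [← hl, List.getElem_map]
    rw [SimpleGraph.Walk.support_getElem_eq_getVert]
  refine ⟨p.getVert, hlen ▸ hp.getVert_injOn, fun i hi => p.adj_getVert_succ (by omega), ?_, ?_,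
    fun i h0 hi => ?_⟩
  · simpa using hget 0 (by omega)
  · simpa using hget (cs.length + 1) (by omega)
  · rw [hget i (by omega)]
    obtain ⟨j, rfl⟩ : ∃ j, i = j + 1 := ⟨i - 1, by omega⟩
    rw [List.getElem_cons_succ, List.getElem_append_left (by omega)]
    exact List.getElem_mem _

theorem ContainsHatnessSequence.winnable {V : Type*} {G : LatvianGame V}
    (hG : ∀ v, 2 ≤ G.hatness v) {cs : List ℕ} (hcs : ∀ x ∈ cs, x = 3 ∨ x = 4)
    (h : G.ContainsHatnessSequence (2 :: (cs ++ [2]))) : G.Winnable := by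
  obtain ⟨v, h1, h2, h3, h4, h5⟩ := h.exists_path
  refine G.winnable_of_path hG (by omega) v h1 h2 h3 h4 fun i hi hi' => ?_
  have := hcs _ (h5 i hi hi')
  omega

theorem ContainsHatnessSequence.winnable_delete {V : Type*} {G : LatvianGame V}
    (hG : ∀ v, 2 ≤ G.hatness v) {a : V} (ha : 5 ≤ G.hatness a) {cs : List ℕ}
    (hcs : ∀ x ∈ cs, x = 3 ∨ x = 4) (h : G.ContainsHatnessSequence (2 :: (cs ++ [2]))) :
    (G.delete a).Winnable := by
  obtain ⟨v, h1, h2, h3, h4, h5⟩ := h.exists_path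
  have hb : ∀ i ≤ cs.length + 1, G.hatness (v i) ≤ 4 := by
    intro i hi
    rcases Nat.eq_zero_or_pos i with rfl | h0
    · omega
    rcases Nat.lt_or_eq_of_le hi with hi | rfl
    · have := hcs _ (h5 i h0 hi)
      omega
    · omega
  have hne : ∀ i ≤ cs.length + 1, v i ≠ a := by
    rintro i hi rfl
    have := hb i hi
    omega
  have h0 := hne 0 (by omega)
  have e : ∀ i ≤ cs.length + 1, min i (cs.length + 1) = i := fun i hi => min_eq_left hi
  -- The `min` keeps the sequence off `a` at indices beyond the path.
  refine (G.delete a).winnable_of_path (fun u => hG u) (L := cs.length + 1) (by omega)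
    (fun i => ⟨v (min i (cs.length + 1)), hne _ (min_le_right _ _)⟩) ?_ ?_ ?_ ?_ ?_
  · intro i hi j hj hij
    have := congrArg Subtype.val hij
    simp only [e i hi, e j hj] at this
    exact h1 hi hj this
  · intro i hi
    simp only [delete, SimpleGraph.comap_adj, Function.Embedding.subtype_apply, e i hi.le,
      e (i + 1) hi]
    exact h2 i hi
  · simpa [delete] using h3
  · simpa [delete] using h4
  · intro i hi hi'
    simp only [delete, e i hi'.le]
    exact hb i hi'.le

end LatvianGame

/-! ### Transfer to the cycle graph -/

open Fin.CommRing in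
/-- The vertices of a cycle are enumerated by the natural numbers, starting after `a`. -/
def cycleVertex {M : ℕ} (a : Fin (M + 4)) (i : ℕ) : Fin (M + 4) := a + 1 + (i : Fin (M + 4))

section

variable {M : ℕ} (a : Fin (M + 4))

open Fin.CommRing

theorem cycleVertex_val_sub (u : Fin (M + 4)) : cycleVertex a (u - (a + 1)).val = u := by
  simp [cycleVertex]

theorem val_cycleVertex_sub (i : ℕ) : (cycleVertex a i - (a + 1)).val = i % (M + 4) := by
  simp [cycleVertex, Fin.val_natCast]

theorem cycleVertex_succ (i : ℕ) : cycleVertex a (i + 1) = cycleVertex a i + 1 := by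
  simp only [cycleVertex]
  push_cast
  ring

theorem cycleVertex_add_pred (i : ℕ) : cycleVertex a (i + (M + 3)) = cycleVertex a i - 1 := by
  rw [eq_sub_iff_add_eq, ← cycleVertex_succ, cycleVertex, cycleVertex,
    show i + (M + 3) + 1 = i + (M + 4) by ring, Nat.cast_add, Fin.natCast_self, add_zero]

theorem cycleVertex_last : cycleVertex a (M + 3) = a := by
  have := cycleVertex_add_pred a 0
  simpa [cycleVertex] using this

theorem cycleVertex_adj_succ (i : ℕ) :
    (SimpleGraph.cycleGraph (M + 4)).Adj (cycleVertex a i) (cycleVertex a (i + 1)) := by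
  rw [SimpleGraph.cycleGraph_adj (n := M + 2), cycleVertex_succ]
  right
  simp

theorem cycleVertex_injOn : Set.InjOn (cycleVertex a) {i | i < M + 4} := by
  intro i hi j hj h
  have := congrArg (fun u => (u - (a + 1)).val) h
  simp only [val_cycleVertex_sub] at this
  rwa [Nat.mod_eq_of_lt hi, Nat.mod_eq_of_lt hj] at this

theorem eq_cycleVertex_of_adj {i : ℕ} {w : Fin (M + 4)}
    (h : (SimpleGraph.cycleGraph (M + 4)).Adj (cycleVertex a i) w) :
    w = cycleVertex a (i + (M + 3)) ∨ w = cycleVertex a (i + 1) := by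
  rw [cycleVertex_succ, cycleVertex_add_pred]
  rw [SimpleGraph.cycleGraph_adj (n := M + 2)] at h
  rcases h with h | h
  · left
    rw [eq_sub_iff_add_eq, ← h]
    ring
  · right
    rw [← h]
    ring

end

theorem exists_containsHatnessSequence {M : ℕ} {h : Fin (M + 4) → ℕ} (hh : ∀ v, 2 ≤ h v)
    (a : Fin (M + 4)) (hs : ¬ TwosSeparated (M + 3) fun i => h (cycleVertex a i)) :
    ∃ cs : List ℕ, (∀ x ∈ cs, x = 3 ∨ x = 4) ∧
      (latvianCycle (M + 4) h).ContainsHatnessSequence (2 :: (cs ++ [2])) := by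
  simp only [TwosSeparated] at hs
  push Not at hs
  obtain ⟨i, j, hij, hj, hi2, hj2, hlt⟩ := hs
  -- Stopping at the first two after `i` excludes hatness two in between.
  have hex : ∃ d, h (cycleVertex a (i + (d + 1))) = 2 :=
    ⟨j - i - 1, by rwa [show i + (j - i - 1 + 1) = j by omega]⟩
  set m := Nat.find hex with hm
  have hmj : m ≤ j - i - 1 :=
    Nat.find_min' hex (by rwa [show i + (j - i - 1 + 1) = j by omega])
  have hm2 : h (cycleVertex a (i + (m + 1))) = 2 := Nat.find_spec hex
  refine ⟨(List.range m).map fun t => h (cycleVertex a (i + (t + 1))), fun x hx => ?_, ?_⟩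
  · obtain ⟨t, ht, rfl⟩ := List.mem_map.1 hx
    have ht := List.mem_range.1 ht
    have h1 := Nat.find_min hex ht
    have h2 := hlt (i + (t + 1)) (by omega) (by omega)
    have h3 := hh (cycleVertex a (i + (t + 1)))
    omega
  · have key := (latvianCycle (M + 4) h).containsHatnessSequence_of_path
      (fun t => cycleVertex a (i + t)) m (fun t _ => cycleVertex_adj_succ a (i + t))
      (fun s hs t ht hst => by
        have hs : s ≤ m + 1 := hs
        have ht : t ≤ m + 1 := ht
        have := cycleVertex_injOn a (show i + s < M + 4 by omega)
          (show i + t < M + 4 by omega) hst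
        omega)
    simp only [latvianCycle, add_zero, hi2, hm2] at key ⊢
    exact key

theorem not_winnable_latvianCycle {M : ℕ} {h : Fin (M + 4) → ℕ} (hh : ∀ v, 2 ≤ h v)
    (a : Fin (M + 4)) (ha : 5 ≤ h a)
    (hs : TwosSeparated (M + 3) fun i => h (cycleVertex a i)) :
    ¬ (latvianCycle (M + 4) h).Winnable := by
  rintro ⟨f, hf⟩
  have clamp_lt : ∀ (u : Fin (M + 4)) (x : ℕ), x % h u < h u := fun u x =>
    Nat.mod_lt _ (by have := hh u; omega)
  -- Colors are reduced modulo the hatness to make `g` total; this changes no legal color.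
  set g : ℕ → ℕ → ℕ → ℕ := fun i l r => (f (cycleVertex a i) fun u =>
    ⟨(if u.1 = cycleVertex a (i + (M + 3)) then l else r) % h u, clamp_lt u _⟩).val with hg
  obtain ⟨c, hc, c0, c1, cN⟩ := exists_disproves (N := M + 3) (by omega) g
    (fun i _ => hh (cycleVertex a i)) (by simpa [cycleVertex_last] using ha) hs
  have hne : ∀ i < M + 4, c i ≠ g i (c ((i + (M + 3)) % (M + 4))) (c ((i + 1) % (M + 4))) := by
    intro i hi
    rcases Nat.eq_zero_or_pos i with rfl | h0
    · simpa [Nat.mod_eq_of_lt] using c0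
    rw [show i + (M + 3) = i - 1 + (M + 4) by omega, Nat.add_mod_right,
      Nat.mod_eq_of_lt (show i - 1 < M + 4 by omega)]
    rcases Nat.lt_or_eq_of_le (Nat.le_of_lt_succ hi) with hi' | rfl
    · obtain ⟨j, rfl⟩ : ∃ j, i = j + 1 := ⟨i - 1, by omega⟩
      rw [Nat.mod_eq_of_lt (by omega)]
      exact c1 j hi'
    · simpa using cN
  have hlt : ∀ u : Fin (M + 4), c (u - (a + 1)).val < h u := by
    intro u
    have := hc (u - (a + 1)).val (by omega)
    dsimp only at this
    rwa [cycleVertex_val_sub] at this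
  obtain ⟨u, hu⟩ := hf fun u => ⟨c (u - (a + 1)).val, hlt u⟩
  obtain ⟨i, hi, rfl⟩ : ∃ i < M + 4, cycleVertex a i = u :=
    ⟨_, (u - (a + 1)).2, cycleVertex_val_sub a u⟩
  refine hne i hi ?_
  have hu := congrArg Fin.val hu
  simp only [val_cycleVertex_sub, Nat.mod_eq_of_lt hi] at hu
  rw [← hu, hg]
  congr 2
  funext w
  refine Fin.ext ?_
  have hw := hlt w.1
  rcases eq_cycleVertex_of_adj a w.2 with e | e
  · simp only [e, if_true, val_cycleVertex_sub] at hw ⊢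
    exact (Nat.mod_eq_of_lt hw).symm
  · have hne' : w.1 ≠ cycleVertex a (i + (M + 3)) := by
      rw [e, cycleVertex_succ, cycleVertex_add_pred]
      intro h
      have := congrArg (fun u => (u - cycleVertex a i).val) h
      simp at this
    simp only [if_neg hne']
    simp only [e, val_cycleVertex_sub] at hw ⊢
    exact (Nat.mod_eq_of_lt hw).symm

theorem mainTheorem2 (k : ℕ) (hk : 4 ≤ k) (h : Fin k → ℕ) (hh : ∀ v, 2 ≤ h v)
    (a : Fin k) (ha : 5 ≤ h a) :
    (latvianCycle k h).Deletable a ∧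
      ((latvianCycle k h).Winnable ↔
        ∃ cs : List ℕ, (∀ x ∈ cs, x = 3 ∨ x = 4) ∧
          (latvianCycle k h).ContainsHatnessSequence (2 :: (cs ++ [2]))) := by
  obtain ⟨M, rfl⟩ : ∃ M, k = M + 4 := ⟨k - 4, by omega⟩
  have necessary : (latvianCycle (M + 4) h).Winnable → ∃ cs : List ℕ, (∀ x ∈ cs, x = 3 ∨ x = 4) ∧
      (latvianCycle (M + 4) h).ContainsHatnessSequence (2 :: (cs ++ [2])) := fun hw =>
    exists_containsHatnessSequence hh a fun hs => not_winnable_latvianCycle hh a ha hs hw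
  refine ⟨⟨LatvianGame.Winnable.of_delete (by change 0 < h a; omega), fun hw => ?_⟩,
    necessary, ?_⟩
  · obtain ⟨cs, hcs, hc⟩ := necessary hw
    exact hc.winnable_delete hh ha hcs
  · rintro ⟨cs, hcs, hc⟩
    exact hc.winnable hh hcs
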